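/- Let $n$ be a natural number and let $P_n$ be the path with vertex set $\{1,\dots,n\}$, in which $j$ and $k$ are adjacent if and only if $|j-k|=1$ (all edges have weight $1$). Put potential $1$ on the end vertices $1$ and $n$ and potential $0$ on all other vertices; that is, consider the Hamiltonian $M=A(P_n)+\Delta$, where $A(P_n)$ is the adjacency matrix and $\Delta$ is the diagonal matrix with $\Delta_{1,1}=\Delta_{n,n}=1$ and all other entries $0$. Let $U(t)=\exp(itM)$ for $t\in\mathbb{R}$. We say that $P_n$ with this potential admits pretty good vertex state transfer if there are vertices $a,b$ with linearly independent characteristic vectors $\mathbf{e}_a,\mathbf{e}_b$ (equivalently $a\neq b$), a sequence of real numbers $(t_k)$ and a complex number $\gamma$ with $|\gamma|=1$ such that $\lim_{k\to\infty}U(t_k)\mathbf{e}_a=\gamma\,\mathbf{e}_b$. Then $P_n$ with potential $1$ only at its end vertices admits pretty good vertex state transfer if and only if $n=2^k$ for some integer $k\ge 1$. Moreover, for $n\ge 2$ this path with potential is a symmetrized quotient graph of the even cycle $C_{2n}$: there is a partition of the vertex set of $C_{2n}$ into nonempty cells $V_1,\dots,V_n$ such that each vertex of $V_j$ is adjacent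 to exactly $c_{jk}$ vertices of $V_k$, with $c_{jk}$ depending only on $j$ and $k$, and $M_{j,k}=\sqrt{c_{jk}c_{kj}}$ for all $j,k$. -/

import Mathlib

open Filter Topology

noncomputable section

namespace QWalk

variable {V : Type*} [Fintype V] [DecidableEq V]

/-- The Hamiltonian `A(G) + Δ` of a simple graph `G` (all edges of weight `1`) with
potential `Δ j` at the vertex `j`. -/
def hamiltonian (G : SimpleGraph V) [DecidableRel G.Adj] (Δ : V → ℝ) : Matrix V V ℝ :=
  G.adjMatrix ℝ + Matrix.diagonal Δ

/-- The transition matrix `U(t) = exp(i t M)` of the continuous-time quantum walk with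
Hamiltonian `M`. -/
def transition (M : Matrix V V ℝ) (t : ℝ) : Matrix V V ℂ :=
  NormedSpace.exp ((Complex.I * (t : ℂ)) • M.map (fun x : ℝ => (x : ℂ)))

/-- A real pure state: a unit vector of `ℝ^V` (for the Euclidean norm). -/
def IsRealPureState (u : V → ℝ) : Prop := u ⬝ᵥ u = 1

/-- Pretty good state transfer between the real pure states `u` and `v`, with respect to the
Hamiltonian `M`: the two states are linearly independent, and `U(t_k) u` converges to `γ v`
for some sequence of real times `t_k` and some complex `γ` of modulus one. -/
def PGST (M : Matrix V V ℝ) (u v : V → ℝ) : Prop :=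
  IsRealPureState u ∧ IsRealPureState v ∧ LinearIndependent ℝ ![u, v] ∧
    ∃ (t : ℕ → ℝ) (γ : ℂ), ‖γ‖ = 1 ∧
      Tendsto (fun k => (transition M (t k)).mulVec (fun j => (u j : ℂ))) atTop
        (𝓝 (γ • fun j => (v j : ℂ)))

/-- The vertex state of `a`: its characteristic vector. -/
def vertexState (a : V) : V → ℝ := Pi.single a 1

/-- Pretty good vertex state transfer: PGST between some two vertex states. (Linear
independence of the states forces the two vertices to be distinct.) -/
def AdmitsVertexPGST (M : Matrix V V ℝ) : Prop :=
  ∃ a b : V, PGST M (vertexState a) (vertexState b)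

/-- The partition of the vertex set of `G` into the (nonempty) cells `V_j = cell⁻¹{j}` is
equitable, every vertex of `V_j` having exactly `c j k` neighbours in `V_k`, and `M` is the
adjacency matrix of the symmetrized quotient graph, with entries `√(c j k * c k j)`. -/
def IsSymmetrizedQuotient {W : Type*} [DecidableEq W] (G : SimpleGraph V) [DecidableRel G.Adj]
    (cell : V → W) (M : Matrix W W ℝ) : Prop :=
  Function.Surjective cell ∧ ∃ c : W → W → ℕ,
    (∀ (v : V) (k : W),
      (Finset.univ.filter fun w => G.Adj v w ∧ cell w = k).card = c (cell v) k) ∧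
    ∀ j k : W, M j k = Real.sqrt ((c j k : ℝ) * (c k j : ℝ))

/-- The potential equal to `1` at the two end vertices of the path `0, 1, …, n - 1` and to `0`
at all other vertices. -/
def endPotential (n : ℕ) (j : Fin n) : ℝ :=
  if (j : ℕ) = 0 ∨ (j : ℕ) + 1 = n then 1 else 0

open Classical in
/-- The Hamiltonian of the path on `n` vertices with potential `1` only at its end vertices. -/
def endPotentialPath (n : ℕ) : Matrix (Fin n) (Fin n) ℝ :=
  hamiltonian (SimpleGraph.pathGraph n) (endPotential n)

end QWalk

end

/-!
The vectors `v_r(j) = cos(πr(2j+1)/(2n))`, `0 ≤ r < n`, are an eigenbasis of the path with end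
potentials, with eigenvalues `λ_r = 2cos(πr/n)`, and the reflection of the path multiplies `v_r`
by `(-1)^r`. If `U(t_k)e_a → γe_b`, pairing with `v_r` gives `|v_r(a)| = |v_r(b)|`. As `v_1` is
injective, `r = 1` forces `b` to be the mirror image of `a`, and then `exp(i t_k λ_r) → γ(-1)^r`
whenever `v_r(a) ≠ 0`.

Multiplying these limits along an integer relation between the `λ_r` yields an equation for `γ`.
Suppose an odd prime `p` divides `n = pq`. The relation `∑_{j < p} λ_{r + 2qj} = 0` gives
`(γ(-1)^r)^p = 1` for `r = 0`, and also for `r = 1` if `n` is even; if `n` is odd,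
`λ_2 + λ_{n-2} = 0` gives `γ^2 = -1`. Either way this is a contradiction.

If `n = 2^k`, the `λ_r` with `r < n/2` are linearly independent over `ℚ`, being sums `ζ^r + ζ^{-r}`
for a primitive `2n`-th root of unity `ζ`, whose minimal polynomial has degree `n`. Kronecker's
theorem then supplies times at which the phases of these `λ_r` tend to the required values, and
`λ_{n-r} = -λ_r` takes care of the remaining ones.

Folding `C_{2n}` along the reflection `v ↦ 2n - 1 - v` gives the path: the two edges that the
reflection flips become loops at the end vertices, that is, the end potentials.
-/

namespace QWalk

section Kronecker

theorem norm_le_of_norm_add_sum_exp_le {σ : Type*} {S : Finset σ} {μ : σ → ℝ}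
    (hμ : ∀ s ∈ S, μ s ≠ 0) {B : ℝ} {w : ℂ} (c : σ → ℂ)
    (h : ∀ t : ℝ, ‖w + ∑ s ∈ S, c s * Circle.exp (t * μ s)‖ ≤ B) : ‖w‖ ≤ B := by
  classical
  induction S using Finset.induction_on generalizing c with
  | empty => simpa using h 0
  | insert a S ha ih =>
    -- Averaging over the half-period `π / μ a` cancels the `a`-term and keeps the bound.
    refine ih (fun s hs => hμ s (Finset.mem_insert_of_mem hs))
      (fun s => c s * ((1 + Circle.exp (Real.pi / μ a * μ s)) / 2)) fun t => ?_
    have exp_a : (Circle.exp (Real.pi / μ a * μ a) : ℂ) = -1 := by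
      rw [div_mul_cancel₀ _ (hμ a (Finset.mem_insert_self a S)), Circle.coe_exp,
        Complex.exp_pi_mul_I]
    have average : w + ∑ s ∈ S, c s * ((1 + Circle.exp (Real.pi / μ a * μ s)) / 2) *
          Circle.exp (t * μ s) =
        ((w + ∑ s ∈ insert a S, c s * Circle.exp (t * μ s)) +
          (w + ∑ s ∈ insert a S, c s * Circle.exp ((t + Real.pi / μ a) * μ s))) / 2 := by
      have split_term (s : σ) : c s * ((1 + Circle.exp (Real.pi / μ a * μ s)) / 2) *
            Circle.exp (t * μ s) =
          (c s * Circle.exp (t * μ s) + c s * Circle.exp ((t + Real.pi / μ a) * μ s)) / 2 := by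
        rw [add_mul, Circle.exp_add, Circle.coe_mul]
        ring
      simp only [split_term, ← Finset.sum_div, Finset.sum_add_distrib, Finset.sum_insert ha]
      rw [add_mul t _ (μ a), Circle.exp_add, Circle.coe_mul, exp_a]
      ring
    rw [average, norm_div, Complex.norm_ofNat, div_le_iff₀ two_pos]
    linarith [norm_add_le_of_le (h t) (h (t + Real.pi / μ a))]

variable {ι : Type*}

/-- The one-parameter subgroup `t ↦ tθ` of the torus `ℝ^ι / ℤ^ι`. -/
def torusFlow (θ : ι → ℝ) : ℝ →+ UnitAddTorus ι where
  toFun t i := (t * θ i : ℝ)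
  map_zero' := by ext; simp
  map_add' s t := by ext; simp [add_mul]

section Characters

variable [Fintype ι] {θ : ι → ℝ}

theorem mFourier_torusFlow (n : ι → ℤ) (t : ℝ) :
    UnitAddTorus.mFourier n (torusFlow θ t) =
      Circle.exp (t * (2 * Real.pi * ∑ i, n i * θ i)) := by
  have factor (i : ι) : fourier (n i) (torusFlow θ t i) =
      (Circle.exp (t * (2 * Real.pi * (n i * θ i))) : ℂ) := by
    rw [torusFlow, AddMonoidHom.coe_mk, ZeroHom.coe_mk, fourier_coe_apply, Circle.coe_exp]
    push_cast
    ring_nf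
  simp only [UnitAddTorus.mFourier, ContinuousMap.coe_mk, factor, Circle.coe_exp,
    ← Complex.exp_sum]
  push_cast [Finset.mul_sum, Finset.sum_mul]
  rfl

theorem mFourier_add_apply (n : ι → ℤ) (x y : UnitAddTorus ι) :
    UnitAddTorus.mFourier n (x + y) = UnitAddTorus.mFourier n x * UnitAddTorus.mFourier n y := by
  simp [UnitAddTorus.mFourier, fourier_apply, AddCircle.toCircle_add, Finset.prod_mul_distrib]

theorem norm_coeff_zero_sub_le (hθ : LinearIndependent ℤ θ) (c : (ι → ℤ) →₀ ℂ)
    (y : UnitAddTorus ι) (w : ℂ) {B : ℝ}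
    (h : ∀ t, ‖(c.sum fun n a => a * UnitAddTorus.mFourier n (y + torusFlow θ t)) - w‖ ≤ B) :
    ‖c 0 - w‖ ≤ B := by
  refine norm_le_of_norm_add_sum_exp_le (S := (c.erase 0).support)
    (μ := fun n => 2 * Real.pi * ∑ i, n i * θ i) (fun n hn => ?_)
    (fun n => c.erase 0 n * UnitAddTorus.mFourier n y) fun t => ?_
  · refine mul_ne_zero Real.two_pi_pos.ne' fun relation => ?_
    have n_eq_zero : n = 0 := funext <|
      Fintype.linearIndependent_iff.mp hθ n (by simpa only [zsmul_eq_mul] using relation)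
    simp [n_eq_zero] at hn
  · convert h t using 2
    rw [← Finsupp.add_sum_erase' c 0 _ (by simp), Finsupp.sum]
    simp only [UnitAddTorus.mFourier_zero, ContinuousMap.one_apply, mul_one,
      mFourier_add_apply, mFourier_torusFlow, mul_assoc]
    ring

theorem exists_trigonometric_polynomial_near (g : C(UnitAddTorus ι, ℂ)) {ε : ℝ} (hε : 0 < ε) :
    ∃ c : (ι → ℤ) →₀ ℂ, ∀ x, ‖(c.sum fun n a => a * UnitAddTorus.mFourier n x) - g x‖ ≤ ε := by
  obtain ⟨P, hP, P_near⟩ : ∃ P ∈ Submodule.span ℂ (Set.range UnitAddTorus.mFourier),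
      dist g P < ε := by
    refine Metric.mem_closure_iff.mp ?_ _ hε
    rw [← Submodule.topologicalClosure_coe, UnitAddTorus.span_mFourier_closure_eq_top]
    trivial
  obtain ⟨c, rfl⟩ := Finsupp.mem_span_range_iff_exists_finsupp.mp hP
  refine ⟨c, fun x => ?_⟩
  have := (ContinuousMap.dist_apply_le_dist x).trans P_near.le
  rwa [dist_comm, dist_eq_norm, Finsupp.sum, ContinuousMap.sum_apply] at this

end Characters

variable [Finite ι] {θ : ι → ℝ}

theorem denseRange_torusFlow (hθ : LinearIndependent ℤ θ) : DenseRange (torusFlow θ) := by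
  cases nonempty_fintype ι
  by_contra not_dense
  set H : AddSubgroup (UnitAddTorus ι) := (torusFlow θ).range.topologicalClosure
  have flow_mem (t : ℝ) : torusFlow θ t ∈ H :=
    AddSubgroup.le_topologicalClosure _ ⟨t, rfl⟩
  obtain ⟨y, hy⟩ : ∃ y, y ∉ H := by
    by_contra! all_mem
    exact not_dense all_mem
  have H_closed : IsClosed (H : Set (UnitAddTorus ι)) :=
    AddSubgroup.isClosed_topologicalClosure _
  have coset_closed : IsClosed ((fun x => x - y) ⁻¹' (H : Set (UnitAddTorus ι))) :=
    H_closed.preimage (by fun_prop)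
  have coset_disjoint : Disjoint (H : Set (UnitAddTorus ι)) ((fun x => x - y) ⁻¹' H) :=
    Set.disjoint_left.mpr fun x hx hxy => hy (by simpa using H.sub_mem hx hxy)
  -- `f` is `0` on `H` and `1` on `y + H`, but the constant coefficient of a trigonometric
  -- polynomial close to `f` is its mean value along both of these cosets.
  obtain ⟨f, f_zero, f_one, -⟩ :=
    exists_continuous_zero_one_of_isClosed H_closed coset_closed coset_disjoint
  let g : C(UnitAddTorus ι, ℂ) := ⟨fun x => f x, by fun_prop⟩
  obtain ⟨c, near⟩ := exists_trigonometric_polynomial_near g (ε := 1 / 3) (by norm_num)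
  have coeff_near_zero : ‖c 0 - 0‖ ≤ 1 / 3 := norm_coeff_zero_sub_le hθ c 0 0 fun t => by
    have g_flow : g (0 + torusFlow θ t) = 0 := by
      simpa [g] using f_zero (flow_mem t)
    exact g_flow ▸ near _
  have coeff_near_one : ‖c 0 - 1‖ ≤ 1 / 3 := norm_coeff_zero_sub_le hθ c y 1 fun t => by
    have g_flow : g (y + torusFlow θ t) = 1 := by
      simpa [g] using f_one (show y + torusFlow θ t - y ∈ H by simpa using flow_mem t)
    exact g_flow ▸ near _
  have := norm_sub_le (c 0 - 0) (c 0 - 1)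
  rw [sub_sub_sub_cancel_left, sub_zero, norm_one] at this
  linarith

theorem exists_seq_tendsto_circleExp (hθ : LinearIndependent ℤ θ) (z : ι → Circle) :
    ∃ t : ℕ → ℝ, ∀ i, Tendsto (fun k => Circle.exp (t k * θ i)) atTop (𝓝 (z i)) := by
  cases nonempty_fintype ι
  choose s hs using fun i => Circle.exp_surjective (z i)
  obtain ⟨u, hu_mem, hu⟩ := mem_closure_iff_seq_limit.mp
    (denseRange_torusFlow hθ fun i => ((s i / (2 * Real.pi) : ℝ) : UnitAddCircle))
  choose t ht using hu_mem
  refine ⟨fun k => 2 * Real.pi * t k, fun i => ?_⟩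
  have lim := (AddCircle.continuous_toCircle.tendsto _).comp (tendsto_pi_nhds.mp hu i)
  convert lim using 2 with k
  · simp only [Function.comp_apply, ← ht, torusFlow, AddMonoidHom.coe_mk, ZeroHom.coe_mk,
      AddCircle.toCircle_apply_mk, div_one, mul_assoc]
  · rw [AddCircle.toCircle_apply_mk, div_one, mul_div_cancel₀ _ Real.two_pi_pos.ne', hs]

end Kronecker

section Transition

theorem tendsto_linearMap_of_span_eq_top {𝕜 E F α : Type*} [Semiring 𝕜] [AddCommMonoid E]
    [Module 𝕜 E] [AddCommMonoid F] [Module 𝕜 F] [TopologicalSpace F] [ContinuousAdd F]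
    [ContinuousConstSMul 𝕜 F] {l : Filter α} {s : Set E} (hs : Submodule.span 𝕜 s = ⊤)
    {f : α → E →ₗ[𝕜] F} {g : E →ₗ[𝕜] F} (h : ∀ x ∈ s, Tendsto (fun a => f a x) l (𝓝 (g x)))
    (x : E) : Tendsto (fun a => f a x) l (𝓝 (g x)) := by
  induction hs ▸ Submodule.mem_top (x := x) using Submodule.span_induction with
  | mem x hx => exact h x hx
  | zero => simpa only [map_zero] using tendsto_const_nhds
  | add x y _ _ hx hy => simpa only [map_add] using hx.add hy
  | smul c x _ hx => simpa only [map_smul] using hx.const_smul c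

theorem tendsto_circleExp_sum {ι : Type*} {S : Finset ι} {μ : ι → ℝ} {t : ℕ → ℝ} {z : ι → ℂ}
    (h : ∀ i ∈ S, Tendsto (fun k => (Circle.exp (t k * μ i) : ℂ)) atTop (𝓝 (z i))) :
    Tendsto (fun k => (Circle.exp (t k * ∑ i ∈ S, μ i) : ℂ)) atTop (𝓝 (∏ i ∈ S, z i)) := by
  refine (tendsto_finsetProd S h).congr fun k => ?_
  simp only [Circle.coe_exp, ← Complex.exp_sum]
  push_cast [Finset.mul_sum, Finset.sum_mul]
  rfl

theorem map_ofReal_mulVec_of_eigenvector {V : Type*} [Fintype V] {M : Matrix V V ℝ}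
    {v : V → ℝ} {μ : ℝ} (h : M.mulVec v = μ • v) :
    (M.map fun x : ℝ => (x : ℂ)).mulVec (fun j => (v j : ℂ)) = (μ : ℂ) • fun j => (v j : ℂ) := by
  ext j
  rw [Pi.smul_apply, smul_eq_mul, ← Complex.ofReal_mul, ← smul_eq_mul, ← Pi.smul_apply, ← h]
  exact (RingHom.map_mulVec Complex.ofRealHom M v j).symm

variable {V : Type*} [DecidableEq V]

theorem linearIndependent_vertexState_iff {a b : V} :
    LinearIndependent ℝ ![vertexState a, vertexState b] ↔ a ≠ b := by
  refine ⟨fun h hab => ?_, fun hab => ?_⟩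
  · exact zero_ne_one (h.injective (a₁ := 0) (a₂ := 1) (congrArg vertexState hab))
  · convert (Pi.linearIndependent_single_one V ℝ).comp ![a, b] (by simpa using hab) using 1
    ext i
    fin_cases i <;> rfl

variable [Fintype V] {M : Matrix V V ℝ}

theorem exp_mulVec_of_eigenvector {A : Matrix V V ℂ} {v : V → ℂ} {μ : ℂ}
    (h : A.mulVec v = μ • v) : (NormedSpace.exp A).mulVec v = Complex.exp μ • v := by
  let : NormedRing (Matrix V V ℂ) := Matrix.linftyOpNormedRing
  let : NormedAlgebra ℂ (Matrix V V ℂ) := Matrix.linftyOpNormedAlgebra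
  have pow_mulVec (k : ℕ) : (A ^ k).mulVec v = μ ^ k • v := by
    induction k with
    | zero => simp
    | succ k ih =>
      rw [pow_succ, ← Matrix.mulVec_mulVec, h, Matrix.mulVec_smul, ih, smul_smul, pow_succ']
  have exp_A := (NormedSpace.exp_series_hasSum_exp' (𝕂 := ℂ) A).map
    ((Matrix.mulVecBilin ℂ ℂ).flip v) (continuous_id.matrix_mulVec continuous_const)
  have exp_μ := (NormedSpace.exp_series_hasSum_exp' (𝕂 := ℂ) μ).smul_const v
  rw [← Complex.exp_eq_exp_ℂ] at exp_μ
  refine exp_A.unique ?_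
  convert exp_μ using 2 with k
  simp [pow_mulVec, smul_smul]

theorem transition_mulVec_of_eigenvector {v : V → ℝ} {μ : ℝ} (h : M.mulVec v = μ • v) (t : ℝ) :
    (transition M t).mulVec (fun j => (v j : ℂ)) =
      (Circle.exp (t * μ) : ℂ) • fun j => (v j : ℂ) := by
  rw [Circle.coe_exp]
  refine exp_mulVec_of_eigenvector ?_
  rw [Matrix.smul_mulVec, map_ofReal_mulVec_of_eigenvector h, smul_smul]
  push_cast
  ring_nf

theorem transition_transpose (hM : M.IsSymm) (t : ℝ) :
    (transition M t).transpose = transition M t := by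
  rw [transition, ← Matrix.exp_transpose, Matrix.transpose_smul, ← Matrix.transpose_map, hM]

theorem dotProduct_transition_mulVec (hM : M.IsSymm) {v : V → ℝ} {μ : ℝ}
    (h : M.mulVec v = μ • v) (t : ℝ) (x : V → ℂ) :
    (fun j => (v j : ℂ)) ⬝ᵥ (transition M t).mulVec x =
      Circle.exp (t * μ) * ((fun j => (v j : ℂ)) ⬝ᵥ x) := by
  rw [Matrix.dotProduct_mulVec, ← Matrix.mulVec_transpose, transition_transpose hM,
    transition_mulVec_of_eigenvector h, smul_dotProduct, smul_eq_mul]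

theorem pgst_vertexState_iff {a b : V} :
    PGST M (vertexState a) (vertexState b) ↔ a ≠ b ∧ ∃ (t : ℕ → ℝ) (γ : ℂ), ‖γ‖ = 1 ∧
      Tendsto (fun k => (transition M (t k)).mulVec (Pi.single a 1)) atTop
        (𝓝 (γ • Pi.single b 1)) := by
  have isRealPureState (c : V) : IsRealPureState (vertexState c) := by
    simp [IsRealPureState, vertexState]
  have coe_vertexState (c : V) : (fun j => (vertexState c j : ℂ)) = Pi.single c 1 := by
    ext j
    simp [vertexState, Pi.single_apply, apply_ite Complex.ofReal]
  simp only [PGST, isRealPureState, linearIndependent_vertexState_iff, coe_vertexState, true_and]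

section Limit

variable {t : ℕ → ℝ} {γ : ℂ} {a b : V} {v : V → ℝ} {μ : ℝ}

theorem tendsto_circleExp_mul_apply (hM : M.IsSymm) (h : M.mulVec v = μ • v)
    (hlim : Tendsto (fun k => (transition M (t k)).mulVec (Pi.single a 1)) atTop
      (𝓝 (γ • Pi.single b 1))) :
    Tendsto (fun k => (Circle.exp (t k * μ) : ℂ) * v a) atTop (𝓝 (γ * v b)) := by
  have dot_lim := ((continuous_const (y := fun j => (v j : ℂ))).dotProduct
    continuous_id).tendsto _ |>.comp hlim
  simpa only [Function.comp_def, id_eq, dotProduct_transition_mulVec hM h, dotProduct_smul,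
    dotProduct_single_one, smul_eq_mul] using dot_lim

theorem abs_apply_eq_of_tendsto (hM : M.IsSymm) (h : M.mulVec v = μ • v) (hγ : ‖γ‖ = 1)
    (hlim : Tendsto (fun k => (transition M (t k)).mulVec (Pi.single a 1)) atTop
      (𝓝 (γ • Pi.single b 1))) : |v a| = |v b| := by
  have norm_lim := (tendsto_circleExp_mul_apply hM h hlim).norm
  simp only [norm_mul, Circle.norm_coe, Complex.norm_real, hγ, one_mul, Real.norm_eq_abs]
    at norm_lim
  exact tendsto_nhds_unique tendsto_const_nhds norm_lim

end Limit

end Transition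

section Path

variable {n : ℕ}

theorem endPotentialPath_isSymm (n : ℕ) : (endPotentialPath n).IsSymm := by
  classical exact (SimpleGraph.isSymm_adjMatrix _).add (Matrix.isSymm_diagonal _)

/-- The right neighbour of `j` in the path with end potentials: the potential at the last vertex
acts as a loop, so a walker stepping off the right end stays where it is. -/
def reflectSucc (j : Fin n) : Fin n := ⟨min (j + 1) (n - 1), by omega⟩

/-- The left neighbour of `j` in the path with end potentials; truncated subtraction keeps a walker
stepping off the left end where it is, as the potential at the first vertex does. -/
def reflectPred (j : Fin n) : Fin n := ⟨j - 1, by omega⟩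

theorem endPotentialPath_apply (hn : 2 ≤ n) (j k : Fin n) :
    endPotentialPath n j k =
      (if k = reflectSucc j then 1 else 0) + (if k = reflectPred j then 1 else 0) := by
  simp only [endPotentialPath, hamiltonian, Matrix.add_apply, Matrix.diagonal_apply,
    SimpleGraph.adjMatrix_apply, SimpleGraph.pathGraph_adj, endPotential, reflectSucc, reflectPred,
    Fin.ext_iff]
  split_ifs <;> first | omega | norm_num

theorem endPotentialPath_mulVec (hn : 2 ≤ n) (x : Fin n → ℝ) (j : Fin n) :
    (endPotentialPath n).mulVec x j = x (reflectSucc j) + x (reflectPred j) := by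
  simp [Matrix.mulVec, dotProduct, endPotentialPath_apply hn, add_mul, Finset.sum_add_distrib]

/-- The `r`-th eigenvector of the path with end potentials: a standing wave, symmetric under both
reflections `j ↦ -1 - j` and `j ↦ 2n - 1 - j`. -/
noncomputable def pathEigenvector (n r : ℕ) (j : Fin n) : ℝ :=
  Real.cos (Real.pi * r * (2 * (j : ℕ) + 1) / (2 * n))

/-- The eigenvalue of the path with end potentials belonging to `pathEigenvector n r`. -/
noncomputable def pathEigenvalue (n r : ℕ) : ℝ := 2 * Real.cos (Real.pi * r / n)

theorem pathEigenvector_reflectSucc (r : ℕ) (j : Fin n) :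
    pathEigenvector n r (reflectSucc j) =
      Real.cos (Real.pi * r * (2 * (j : ℕ) + 1) / (2 * n) + Real.pi * r / n) := by
  have hn : (n : ℝ) ≠ 0 := Nat.cast_ne_zero.mpr j.pos.ne'
  rcases (show (j : ℕ) + 1 < n ∨ (j : ℕ) + 1 = n by omega) with h | h
  · rw [pathEigenvector, reflectSucc, Fin.val_mk, min_eq_left (by omega)]
    congr 1
    push_cast
    field_simp
    ring
  · rw [pathEigenvector, reflectSucc, Fin.val_mk, min_eq_right (by omega),
      show n - 1 = (j : ℕ) by omega, ← Real.cos_nat_mul_two_pi_sub _ r]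
    congr 1
    have hj : (j : ℝ) = n - 1 := eq_sub_of_add_eq (mod_cast h)
    rw [hj]
    field_simp
    ring

theorem pathEigenvector_reflectPred (r : ℕ) (j : Fin n) :
    pathEigenvector n r (reflectPred j) =
      Real.cos (Real.pi * r * (2 * (j : ℕ) + 1) / (2 * n) - Real.pi * r / n) := by
  have hn : (n : ℝ) ≠ 0 := Nat.cast_ne_zero.mpr j.pos.ne'
  rcases (j : ℕ).eq_zero_or_pos with h | h
  · rw [pathEigenvector, reflectPred, Fin.val_mk, h, ← Real.cos_neg]
    congr 1
    push_cast
    field_simp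
    ring
  · rw [pathEigenvector, reflectPred, Fin.val_mk, Nat.cast_sub h]
    congr 1
    push_cast
    field_simp
    ring

theorem endPotentialPath_mulVec_pathEigenvector (hn : 2 ≤ n) (r : ℕ) :
    (endPotentialPath n).mulVec (pathEigenvector n r) =
      pathEigenvalue n r • pathEigenvector n r := by
  ext j
  rw [endPotentialPath_mulVec hn, pathEigenvector_reflectSucc, pathEigenvector_reflectPred,
    Pi.smul_apply, smul_eq_mul, pathEigenvalue, pathEigenvector, Real.cos_add, Real.cos_sub]
  ring

theorem pathEigenvector_rev (r : ℕ) (j : Fin n) :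
    pathEigenvector n r j.rev = (-1) ^ r * pathEigenvector n r j := by
  have hn : (n : ℝ) ≠ 0 := Nat.cast_ne_zero.mpr j.pos.ne'
  rw [pathEigenvector, pathEigenvector, Fin.val_rev, Nat.cast_sub j.2, ← Real.cos_nat_mul_pi_sub]
  congr 1
  push_cast
  field_simp
  ring

theorem pathEigenvector_eq_zero_iff {r : ℕ} {j : Fin n} :
    pathEigenvector n r j = 0 ↔ ∃ k : ℤ, (r * (2 * (j : ℕ) + 1) : ℤ) = n * (2 * k + 1) := by
  have hn : (n : ℝ) ≠ 0 := Nat.cast_ne_zero.mpr j.pos.ne'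
  rw [pathEigenvector, Real.cos_eq_zero_iff]
  refine exists_congr fun k => ?_
  rw [div_eq_div_iff (by positivity) two_ne_zero, ← @Int.cast_inj ℝ]
  push_cast
  constructor
  · intro h
    apply mul_left_cancel₀ Real.pi_ne_zero
    linarith
  · intro h
    linear_combination 2 * Real.pi * h

theorem pathEigenvector_zero_pos {r : ℕ} (hr : r < n) : 0 < pathEigenvector n r ⟨0, by omega⟩ := by
  have hr' : (r : ℝ) < n := mod_cast hr
  have hn : (0 : ℝ) < n := r.cast_nonneg.trans_lt hr'
  rw [pathEigenvector]
  refine Real.cos_pos_of_mem_Ioo ⟨?_, ?_⟩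
  · exact (neg_neg_of_pos Real.pi_div_two_pos).trans_le (by positivity)
  · rw [div_lt_div_iff₀ (by positivity) two_pos]
    push_cast
    nlinarith [Real.pi_pos]

theorem pathEigenvector_one_injective (n : ℕ) : Function.Injective (pathEigenvector n 1) := by
  intro a b hab
  have hn : (0 : ℝ) < n := Nat.cast_pos.mpr a.pos
  have angle_mem (j : Fin n) :
      Real.pi * (1 : ℕ) * (2 * (j : ℕ) + 1) / (2 * n) ∈ Set.Icc 0 Real.pi := by
    have : (j : ℝ) + 1 ≤ n := mod_cast j.2
    refine ⟨by positivity, ?_⟩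
    rw [div_le_iff₀ (by positivity)]
    push_cast
    nlinarith [Real.pi_pos]
  have angle_eq := Real.injOn_cos (angle_mem a) (angle_mem b) hab
  field_simp at angle_eq
  exact Fin.ext (by exact_mod_cast (by linarith : (a : ℝ) = b))

theorem eq_or_eq_rev_of_abs_pathEigenvector_one_eq {a b : Fin n}
    (h : |pathEigenvector n 1 a| = |pathEigenvector n 1 b|) : a = b ∨ a = b.rev := by
  refine (abs_eq_abs.mp h).imp (fun h => pathEigenvector_one_injective n h)
    fun h => pathEigenvector_one_injective n ?_
  rw [h, pathEigenvector_rev, pow_one, neg_one_mul]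

theorem pathEigenvalue_injOn (n : ℕ) : Set.InjOn (pathEigenvalue n) (Set.Iio n) := by
  intro r (hr : r < n) s (hs : s < n) h
  have hn : (0 : ℝ) < n := Nat.cast_pos.mpr (by omega)
  have angle_mem {m : ℕ} (hm : m < n) : Real.pi * m / n ∈ Set.Icc 0 Real.pi := by
    refine ⟨by positivity, ?_⟩
    rw [div_le_iff₀ hn]
    exact mul_le_mul_of_nonneg_left (mod_cast hm.le) Real.pi_pos.le
  have angle_eq := Real.injOn_cos (angle_mem hr) (angle_mem hs) (mul_left_cancel₀ two_ne_zero h)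
  field_simp at angle_eq
  exact_mod_cast angle_eq

theorem span_range_pathEigenvector (hn : 2 ≤ n) :
    Submodule.span ℂ (Set.range fun (r : Fin n) j => (pathEigenvector n r j : ℂ)) = ⊤ := by
  have : Nonempty (Fin n) := ⟨⟨0, by omega⟩⟩
  refine LinearIndependent.span_eq_top_of_card_eq_finrank
    (Module.End.eigenvectors_linearIndependent'
      (Matrix.toLin' ((endPotentialPath n).map fun x : ℝ => (x : ℂ)))
      (fun r : Fin n => (pathEigenvalue n r : ℂ)) (fun r s h => ?_) _ fun r => ?_) (by simp)
  · exact Fin.ext (pathEigenvalue_injOn n r.2 s.2 (Complex.ofReal_injective h))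
  · rw [Module.End.hasEigenvector_iff, Module.End.mem_eigenspace_iff, Matrix.toLin'_apply,
      map_ofReal_mulVec_of_eigenvector (endPotentialPath_mulVec_pathEigenvector hn r)]
    refine ⟨rfl, fun h => (pathEigenvector_zero_pos r.2).ne' ?_⟩
    exact Complex.ofReal_eq_zero.mp (congrFun h ⟨0, by omega⟩)

theorem pathEigenvalue_eq_neg_of_add_eq {r s : ℕ} (hn : n ≠ 0) (h : r + s = n) :
    pathEigenvalue n r = -pathEigenvalue n s := by
  have hn' : (n : ℝ) ≠ 0 := Nat.cast_ne_zero.mpr hn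
  rw [pathEigenvalue, pathEigenvalue, ← mul_neg, ← Real.cos_pi_sub, ← h]
  rw [← h] at hn'
  congr 2
  field_simp
  push_cast
  ring

theorem sum_pathEigenvalue_eq_zero {p q : ℕ} (hp : 1 < p) (hq : 0 < q) (r : ℕ) :
    ∑ j ∈ Finset.range p, pathEigenvalue (p * q) (r + 2 * q * j) = 0 := by
  have hp' : (p : ℂ) ≠ 0 := Nat.cast_ne_zero.mpr (by omega)
  have hq' : (q : ℂ) ≠ 0 := Nat.cast_ne_zero.mpr hq.ne'
  have term_eq (j : ℕ) : pathEigenvalue (p * q) (r + 2 * q * j) =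
      2 * (Complex.exp (Real.pi * r / (p * q) * Complex.I) *
        Complex.exp (2 * Real.pi * Complex.I / p) ^ j).re := by
    rw [pathEigenvalue, ← Complex.exp_ofReal_mul_I_re, ← Complex.exp_nat_mul, ← Complex.exp_add]
    congr 3
    push_cast
    field_simp
  have geom_sum := (Complex.isPrimitiveRoot_exp p (by omega)).geom_sum_eq_zero hp
  simp only [term_eq, ← Finset.mul_sum, ← Complex.re_sum, geom_sum, mul_zero, Complex.zero_re]

end Path

section Necessity

variable {n : ℕ} {a : Fin n} {t : ℕ → ℝ} {γ : ℂ}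

/-- The phase condition for pretty good state transfer from `a` to its mirror image `a.rev`: along
the times `t`, the phase of each eigenvector in the support of `a` tends to `γ` times the parity of
that eigenvector under the mirror symmetry. -/
def HasMirrorPhases (a : Fin n) (t : ℕ → ℝ) (γ : ℂ) : Prop :=
  ∀ r, pathEigenvector n r a ≠ 0 →
    Tendsto (fun k => (Circle.exp (t k * pathEigenvalue n r) : ℂ)) atTop (𝓝 (γ * (-1) ^ r))

theorem hasMirrorPhases_of_tendsto (hn : 2 ≤ n)
    (hlim : Tendsto (fun k => (transition (endPotentialPath n) (t k)).mulVec (Pi.single a 1)) atTop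
      (𝓝 (γ • Pi.single a.rev 1))) : HasMirrorPhases a t γ := by
  intro r hr
  have lim := (tendsto_circleExp_mul_apply (endPotentialPath_isSymm n)
    (endPotentialPath_mulVec_pathEigenvector hn r) hlim).div_const (pathEigenvector n r a : ℂ)
  have hr' : (pathEigenvector n r a : ℂ) ≠ 0 := Complex.ofReal_ne_zero.mpr hr
  simp only [pathEigenvector_rev, mul_div_cancel_right₀ _ hr'] at lim
  convert lim using 2
  push_cast
  field_simp

theorem AdmitsVertexPGST.exists_hasMirrorPhases (hn : 2 ≤ n)
    (h : AdmitsVertexPGST (endPotentialPath n)) :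
    ∃ (a : Fin n) (t : ℕ → ℝ) (γ : ℂ), a ≠ a.rev ∧ HasMirrorPhases a t γ := by
  obtain ⟨a, b, hab⟩ := h
  obtain ⟨a_ne_b, t, γ, hγ, hlim⟩ := pgst_vertexState_iff.mp hab
  have abs_eq := abs_apply_eq_of_tendsto (endPotentialPath_isSymm n)
    (endPotentialPath_mulVec_pathEigenvector hn 1) hγ hlim
  obtain rfl : b = a.rev :=
    (eq_or_eq_rev_of_abs_pathEigenvector_one_eq abs_eq.symm).resolve_left a_ne_b.symm
  exact ⟨a, t, γ, a_ne_b, hasMirrorPhases_of_tendsto hn hlim⟩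

namespace HasMirrorPhases

theorem prod_eq_one (h : HasMirrorPhases a t γ) {ι : Type*} {S : Finset ι} {r : ι → ℕ}
    (support : ∀ i ∈ S, pathEigenvector n (r i) a ≠ 0)
    (relation : ∑ i ∈ S, pathEigenvalue n (r i) = 0) : ∏ i ∈ S, γ * (-1) ^ r i = 1 := by
  have lim := tendsto_circleExp_sum fun i hi => h (r i) (support i hi)
  simp only [relation, mul_zero, Circle.exp_zero, Circle.coe_one] at lim
  exact tendsto_nhds_unique lim tendsto_const_nhds

theorem pow_eq_one {p q r : ℕ} {a : Fin (p * q)} (h : HasMirrorPhases a t γ) (hp : 1 < p)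
    (support : ∀ j, pathEigenvector (p * q) (r + 2 * q * j) a ≠ 0) : (γ * (-1) ^ r) ^ p = 1 := by
  have prod := h.prod_eq_one (fun j _ => support j)
    (sum_pathEigenvalue_eq_zero hp (Nat.pos_of_mul_pos_left a.pos) r)
  simpa [pow_add, mul_assoc, pow_mul] using prod

end HasMirrorPhases

theorem pathEigenvector_ne_zero_of_even_of_odd {r : ℕ} (hn : Even n) (hr : Odd r) (a : Fin n) :
    pathEigenvector n r a ≠ 0 := by
  rw [Ne, pathEigenvector_eq_zero_iff]
  rintro ⟨k, hk⟩
  have even_right : Even (n * (2 * k + 1) : ℤ) := (mod_cast hn : Even (n : ℤ)).mul_right _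
  have odd_left : Odd (r * (2 * (a : ℕ) + 1) : ℤ) :=
    (mod_cast hr : Odd (r : ℤ)).mul ⟨_, rfl⟩
  exact Int.not_even_iff_odd.mpr odd_left (hk ▸ even_right)

theorem pathEigenvector_two_mul_ne_zero {p q : ℕ} (hn : n = p * q) (hp : Odd p) (j : ℕ)
    (a : Fin n) : pathEigenvector n (2 * q * j) a ≠ 0 := by
  subst hn
  rw [Ne, pathEigenvector_eq_zero_iff]
  rintro ⟨k, hk⟩
  have hq : (q : ℤ) ≠ 0 := Nat.cast_ne_zero.mpr (Nat.pos_of_mul_pos_left a.pos).ne'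
  have cancelled : (2 * (j * (2 * (a : ℕ) + 1)) : ℤ) = p * (2 * k + 1) := by
    apply mul_left_cancel₀ hq
    push_cast at hk
    linear_combination hk
  have odd_right : Odd (p * (2 * k + 1) : ℤ) := (mod_cast hp : Odd (p : ℤ)).mul ⟨k, rfl⟩
  exact Int.not_even_iff_odd.mpr odd_right (cancelled ▸ even_two_mul _)

theorem pathEigenvector_sub_two_ne_zero (hn2 : 2 ≤ n) (ha : a ≠ a.rev) :
    pathEigenvector n (n - 2) a ≠ 0 := by
  rw [Ne, pathEigenvector_eq_zero_iff]
  rintro ⟨k, hk⟩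
  rw [Nat.cast_sub hn2, Nat.cast_two] at hk
  have multiple : (n * (a - k) : ℤ) = 2 * (a : ℕ) + 1 := by linarith
  have quotient_pos : 0 < (a - k : ℤ) := by
    refine pos_of_mul_pos_right (a := (n : ℤ)) ?_ (by positivity)
    omega
  have quotient_lt : (a - k : ℤ) < 2 := by
    refine lt_of_mul_lt_mul_left (a := (n : ℤ)) ?_ (by positivity)
    omega
  rw [show (a - k : ℤ) = 1 by omega] at multiple
  exact ha (Fin.ext (by rw [Fin.val_rev]; omega))

theorem HasMirrorPhases.sq_eq_neg_one (h : HasMirrorPhases a t γ) (hn : Odd n) (hn2 : 2 ≤ n)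
    (ha : a ≠ a.rev) : γ ^ 2 = -1 := by
  have two_ne : 2 ≠ n - 2 := fun h2 => by
    obtain ⟨m, hm⟩ := hn
    omega
  have support_two : pathEigenvector n 2 a ≠ 0 :=
    pathEigenvector_two_mul_ne_zero (mul_one n).symm hn 1 a
  have prod := h.prod_eq_one (S := {2, n - 2}) (r := id)
    (by simpa [support_two] using pathEigenvector_sub_two_ne_zero hn2 ha)
    (by rw [Finset.sum_pair two_ne, id, id,
      pathEigenvalue_eq_neg_of_add_eq (by omega) (Nat.add_sub_of_le hn2), neg_add_cancel])
  have odd_sub : Odd (n - 2) := Nat.Odd.sub_even hn2 hn even_two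
  rw [Finset.prod_pair two_ne, id, id, even_two.neg_one_pow, odd_sub.neg_one_pow] at prod
  linear_combination -prod

theorem not_admitsVertexPGST_mul {p q : ℕ} (hp : Odd p) (hp1 : 1 < p) (hq : 0 < q) :
    ¬ AdmitsVertexPGST (endPotentialPath (p * q)) := by
  intro h
  have hn : 2 ≤ p * q := hp1.trans_le (Nat.le_mul_of_pos_right p hq)
  obtain ⟨a, t, γ, a_ne_rev, phases⟩ := h.exists_hasMirrorPhases hn
  have γ_pow : γ ^ p = 1 := by
    simpa using phases.pow_eq_one (r := 0) hp1 fun j => by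
      simpa using pathEigenvector_two_mul_ne_zero rfl hp j a
  rcases Nat.even_or_odd q with q_even | q_odd
  · have neg_γ_pow : (-γ) ^ p = 1 := by
      simpa using phases.pow_eq_one (r := 1) hp1 fun j =>
        pathEigenvector_ne_zero_of_even_of_odd (q_even.mul_left p)
          (((even_two_mul q).mul_right j).one_add) a
    rw [hp.neg_pow, γ_pow] at neg_γ_pow
    norm_num at neg_γ_pow
  · have γ_sq := phases.sq_eq_neg_one (hp.mul q_odd) hn a_ne_rev
    have contradiction : (γ ^ 2) ^ p = 1 := by rw [pow_right_comm, γ_pow, one_pow]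
    rw [γ_sq, hp.neg_one_pow] at contradiction
    norm_num at contradiction

theorem two_le_of_admitsVertexPGST (h : AdmitsVertexPGST (endPotentialPath n)) : 2 ≤ n := by
  obtain ⟨a, b, hab⟩ := h
  have a_ne_b := (pgst_vertexState_iff.mp hab).1
  omega

theorem eq_two_pow_of_admitsVertexPGST (h : AdmitsVertexPGST (endPotentialPath n)) :
    ∃ k : ℕ, 1 ≤ k ∧ n = 2 ^ k := by
  have hn := two_le_of_admitsVertexPGST h
  obtain ⟨k, rfl⟩ | ⟨p, p_prime, ⟨q, rfl⟩, p_odd⟩ := n.eq_two_pow_or_exists_odd_prime_and_dvd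
  · exact ⟨k, Nat.one_le_iff_ne_zero.mpr (by rintro rfl; simp at hn), rfl⟩
  · exact absurd h (not_admitsVertexPGST_mul p_odd p_prime.one_lt
      (Nat.pos_of_mul_pos_left (two_pos.trans_le hn)))

end Necessity

section Sufficiency

variable {n : ℕ}

open Polynomial in
theorem linearIndependent_pow_add_inv_pow {K L : Type*} [Field K] [Field L] [Algebra K L]
    (h2 : (2 : K) ≠ 0) {ζ : L} (hζ : ζ ≠ 0) {N : ℕ} (hN : 2 * N ≤ (minpoly K ζ).natDegree) :
    LinearIndependent K fun r : Fin N => ζ ^ (r : ℕ) + ζ⁻¹ ^ (r : ℕ) := by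
  rw [Fintype.linearIndependent_iff]
  intro c relation s
  -- `P` is `∑ r, c r * (X ^ r + X ^ (-r))`, cleared of negative powers by the factor `X ^ N`.
  let P : K[X] := ∑ r : Fin N, (monomial (N + r) (c r) + monomial (N - r) (c r))
  have degree_P : P.degree < (2 * N : ℕ) := by
    refine (degree_sum_le _ _).trans_lt <| (Finset.sup_lt_iff (WithBot.bot_lt_coe _)).mpr
      fun r _ => (degree_add_le _ _).trans_lt (max_lt ?_ ?_) <;>
      exact (degree_monomial_le _ _).trans_lt (by norm_cast; omega)
  have P_root : aeval ζ P = 0 := by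
    rw [← mul_zero (ζ ^ N), ← relation, map_sum, Finset.mul_sum]
    refine Finset.sum_congr rfl fun r _ => ?_
    rw [map_add, aeval_monomial, aeval_monomial, pow_add, pow_sub₀ ζ hζ r.2.le, Algebra.smul_def,
      inv_pow]
    ring
  have P_zero : P = 0 := by
    by_contra P_ne_zero
    refine degree_P.not_ge ?_
    rw [degree_eq_natDegree P_ne_zero, Nat.cast_le]
    exact hN.trans (natDegree_le_natDegree (minpoly.degree_le_of_ne_zero K ζ P_ne_zero P_root))
  have coeff_P : P.coeff (N + s) = c s + if (s : ℕ) = 0 then c s else 0 := by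
    have lower_index (r : Fin N) : N - r = N + s ↔ r = s ∧ (s : ℕ) = 0 := by omega
    simp [P, finsetSum_coeff, coeff_monomial, Finset.sum_add_distrib, Fin.val_inj, lower_index,
      ite_and]
  rw [P_zero, coeff_zero] at coeff_P
  split_ifs at coeff_P
  · rw [← two_mul] at coeff_P
    exact (mul_eq_zero.mp coeff_P.symm).resolve_left h2
  · rw [add_zero] at coeff_P
    exact coeff_P.symm

theorem ofReal_pathEigenvalue (hn : n ≠ 0) (r : ℕ) :
    (pathEigenvalue n r : ℂ) = Complex.exp (2 * Real.pi * Complex.I / (2 * n : ℕ)) ^ r +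
      (Complex.exp (2 * Real.pi * Complex.I / (2 * n : ℕ)))⁻¹ ^ r := by
  have hn' : (n : ℂ) ≠ 0 := Nat.cast_ne_zero.mpr hn
  rw [inv_pow, ← Complex.exp_nat_mul, ← Complex.exp_neg, pathEigenvalue]
  push_cast
  rw [Complex.two_cos]
  congr 2 <;> field_simp

theorem linearIndependent_pathEigenvalue (hn : n ≠ 0) :
    LinearIndependent ℚ fun r : Fin ((2 * n).totient / 2) => pathEigenvalue n r := by
  have ζ_primitive := Complex.isPrimitiveRoot_exp (2 * n) (by positivity)
  have complex_independent : LinearIndependent ℚ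
      fun r : Fin ((2 * n).totient / 2) => (pathEigenvalue n r : ℂ) := by
    simp only [ofReal_pathEigenvalue hn]
    refine linearIndependent_pow_add_inv_pow two_ne_zero (Complex.exp_ne_zero _) ?_
    rw [← Polynomial.cyclotomic_eq_minpoly_rat ζ_primitive (by positivity),
      Polynomial.natDegree_cyclotomic]
    exact Nat.mul_div_le _ 2
  exact .of_comp (Complex.ofRealCLM.toLinearMap.restrictScalars ℚ) complex_independent

theorem tendsto_transition_of_phases (hn : 2 ≤ n) {t : ℕ → ℝ} {γ : ℂ}
    (phases : ∀ r < n, Tendsto (fun k => (Circle.exp (t k * pathEigenvalue n r) : ℂ)) atTop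
      (𝓝 (γ * (-1) ^ r))) (a : Fin n) :
    Tendsto (fun k => (transition (endPotentialPath n) (t k)).mulVec (Pi.single a 1)) atTop
      (𝓝 (γ • Pi.single a.rev 1)) := by
  have lim := tendsto_linearMap_of_span_eq_top (span_range_pathEigenvector hn)
    (f := fun k => (transition (endPotentialPath n) (t k)).mulVecLin)
    (g := γ • LinearMap.funLeft ℂ ℂ Fin.rev) (l := atTop) ?_ (Pi.single a 1)
  · simp only [Matrix.mulVecLin_apply] at lim
    convert lim using 2
    ext j
    simp [LinearMap.funLeft_apply, Pi.single_apply, Fin.rev_eq_iff]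
  · rintro _ ⟨r, rfl⟩
    simp only [Matrix.mulVecLin_apply,
      transition_mulVec_of_eigenvector (endPotentialPath_mulVec_pathEigenvector hn r)]
    convert (phases r r.2).smul_const fun j => (pathEigenvector n r j : ℂ) using 2
    ext j
    simp [LinearMap.funLeft_apply, pathEigenvector_rev, mul_assoc]

theorem exists_times_tendsto_phases (k : ℕ) : ∃ t : ℕ → ℝ, ∀ r < 2 ^ (k + 1),
    Tendsto (fun m => Circle.exp (t m * pathEigenvalue (2 ^ (k + 1)) r)) atTop
      (𝓝 ((-1) ^ 2 ^ k * (-1) ^ r)) := by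
  have hn : 2 ^ (k + 1) ≠ 0 := by positivity
  have two_pow : 2 ^ (k + 1) = 2 ^ k + 2 ^ k := by ring
  have half_totient : (2 * 2 ^ (k + 1)).totient / 2 = 2 ^ k := by
    rw [← pow_succ', Nat.totient_prime_pow_succ Nat.prime_two, pow_succ]
    simp
  have independent := LinearIndependent.iff_fractionRing ℤ ℚ |>.mpr
    (linearIndependent_pathEigenvalue hn)
  rw [half_totient] at independent
  obtain ⟨t, ht⟩ := exists_seq_tendsto_circleExp independent
    fun r => (-1) ^ 2 ^ k * (-1) ^ (r : ℕ)
  refine ⟨t, fun r hr => ?_⟩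
  rcases lt_trichotomy r (2 ^ k) with r_lt | rfl | r_gt
  · exact ht ⟨r, r_lt⟩
  · have middle := pathEigenvalue_eq_neg_of_add_eq hn two_pow.symm
    simp [self_eq_neg.mp middle, ← mul_pow]
  · have lim := (ht ⟨2 ^ (k + 1) - r, by omega⟩).inv
    simp only [← Circle.exp_neg, ← mul_neg] at lim
    rw [← pathEigenvalue_eq_neg_of_add_eq hn (Nat.add_sub_of_le hr.le)] at lim
    convert lim using 2
    have parity : Even (2 ^ k + r + (2 ^ k + (2 ^ (k + 1) - r))) := ⟨2 ^ (k + 1), by omega⟩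
    rw [← pow_add, ← pow_add]
    exact eq_inv_of_mul_eq_one_left (by rw [← pow_add, parity.neg_one_pow])

theorem admitsVertexPGST_two_pow (k : ℕ) : AdmitsVertexPGST (endPotentialPath (2 ^ (k + 1))) := by
  have hn : 2 ≤ 2 ^ (k + 1) := Nat.le_self_pow k.succ_ne_zero 2
  obtain ⟨t, ht⟩ := exists_times_tendsto_phases k
  refine ⟨⟨0, by omega⟩, Fin.rev ⟨0, by omega⟩, pgst_vertexState_iff.mpr
    ⟨?_, t, (-1) ^ 2 ^ k, by simp, tendsto_transition_of_phases hn (fun r hr => ?_) _⟩⟩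
  · simp only [Ne, Fin.ext_iff, Fin.val_rev]
    omega
  · convert (continuous_subtype_val.tendsto _).comp (ht r hr) using 2
    · rfl
    · push_cast
      simp

end Sufficiency

section Cycle

theorem cycleGraph_adj_iff {N : ℕ} [NeZero N] (hN : 2 ≤ N) {v w : Fin N} :
    (SimpleGraph.cycleGraph N).Adj v w ↔ w = v + 1 ∨ w = v - 1 := by
  obtain ⟨m, rfl⟩ := Nat.exists_eq_add_of_le' hN
  rw [SimpleGraph.cycleGraph_adj, or_comm, sub_eq_iff_eq_add', sub_eq_iff_eq_add,
    eq_sub_iff_add_eq', eq_comm (a := v)]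

theorem val_add_one_eq_ite {N : ℕ} [NeZero N] (hN : 2 ≤ N) (v : Fin N) :
    ((v + 1 : Fin N) : ℕ) = if v + 1 = N then 0 else (v : ℕ) + 1 := by
  rw [Fin.val_add_eq_ite, Fin.val_one', Nat.mod_eq_of_lt hN]
  split_ifs <;> omega

theorem val_sub_one_eq_ite {N : ℕ} [NeZero N] (hN : 2 ≤ N) (v : Fin N) :
    ((v - 1 : Fin N) : ℕ) = if (v : ℕ) = 0 then N - 1 else v - 1 := by
  have val_one : ((1 : Fin N) : ℕ) = 1 := by rw [Fin.val_one', Nat.mod_eq_of_lt hN]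
  split_ifs with hv
  · rw [Fin.val_sub, val_one, hv, add_zero, Nat.mod_eq_of_lt (by omega)]
  · rw [Fin.sub_val_of_le (by rw [Fin.le_def]; omega), val_one]

theorem add_one_ne_sub_one {N : ℕ} [NeZero N] (hN : 3 ≤ N) (v : Fin N) : v + 1 ≠ v - 1 := by
  rw [Ne, Fin.ext_iff, val_add_one_eq_ite (by omega), val_sub_one_eq_ite (by omega)]
  split_ifs <;> omega

/-- The quotient map of the cycle `C_{2n}` onto the path, folding it along the reflection
`v ↦ 2n - 1 - v`. -/
def cycleFold (n : ℕ) (v : Fin (2 * n)) : Fin n := ⟨min v (2 * n - 1 - v), by omega⟩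

theorem cycleFold_surjective (n : ℕ) : Function.Surjective (cycleFold n) := fun j =>
  ⟨⟨j, by omega⟩, Fin.ext (min_eq_left (show (j : ℕ) ≤ 2 * n - 1 - j by omega))⟩

theorem cycleFold_neighbors {n : ℕ} [NeZero (2 * n)] (v : Fin (2 * n)) :
    (cycleFold n (v + 1) = reflectSucc (cycleFold n v) ∧
      cycleFold n (v - 1) = reflectPred (cycleFold n v)) ∨
    (cycleFold n (v + 1) = reflectPred (cycleFold n v) ∧
      cycleFold n (v - 1) = reflectSucc (cycleFold n v)) := by
  have hN : 2 ≤ 2 * n := by have := v.isLt; omega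
  simp only [cycleFold, reflectSucc, reflectPred, Fin.ext_iff,
    val_add_one_eq_ite hN, val_sub_one_eq_ite hN]
  split_ifs <;> omega

theorem card_filter_cycleFold {n : ℕ} (hn : 2 ≤ n) (v : Fin (2 * n)) (k : Fin n)
    [DecidableRel (SimpleGraph.cycleGraph (2 * n)).Adj] :
    (Finset.univ.filter fun w => (SimpleGraph.cycleGraph (2 * n)).Adj v w ∧ cycleFold n w = k).card
      = (if k = reflectSucc (cycleFold n v) then 1 else 0) +
        (if k = reflectPred (cycleFold n v) then 1 else 0) := by
  have : NeZero (2 * n) := ⟨by omega⟩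
  have neighbors : (Finset.univ.filter fun w =>
      (SimpleGraph.cycleGraph (2 * n)).Adj v w ∧ cycleFold n w = k) =
      ({v + 1, v - 1} : Finset _).filter fun w => cycleFold n w = k := by
    ext w
    simp [cycleGraph_adj_iff (show 2 ≤ 2 * n by omega)]
  rw [neighbors, Finset.card_filter, Finset.sum_pair (add_one_ne_sub_one (by omega) v)]
  rcases cycleFold_neighbors v with ⟨succ_eq, pred_eq⟩ | ⟨succ_eq, pred_eq⟩
  · simp only [succ_eq, pred_eq, eq_comm]
  · rw [succ_eq, pred_eq, add_comm]
    simp only [eq_comm]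

theorem isSymmetrizedQuotient_cycleFold {n : ℕ} (hn : 2 ≤ n) :
    IsSymmetrizedQuotient (SimpleGraph.cycleGraph (2 * n)) (cycleFold n) (endPotentialPath n) := by
  refine ⟨cycleFold_surjective n, fun j k =>
    (if k = reflectSucc j then 1 else 0) + (if k = reflectPred j then 1 else 0),
    fun v k => card_filter_cycleFold hn v k, fun j k => ?_⟩
  push_cast
  rw [← endPotentialPath_apply hn, ← endPotentialPath_apply hn,
    (endPotentialPath_isSymm n).apply, Real.sqrt_mul_self]
  rw [endPotentialPath_apply hn]
  positivity

end Cycle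

end QWalk

theorem mainTheorem12 (n : ℕ) :
    (QWalk.AdmitsVertexPGST (QWalk.endPotentialPath n) ↔ ∃ k : ℕ, 1 ≤ k ∧ n = 2 ^ k) ∧
    (2 ≤ n → ∃ cell : Fin (2 * n) → Fin n,
      QWalk.IsSymmetrizedQuotient (SimpleGraph.cycleGraph (2 * n)) cell
        (QWalk.endPotentialPath n)) := by
  refine ⟨⟨QWalk.eq_two_pow_of_admitsVertexPGST, ?_⟩, fun hn =>
    ⟨QWalk.cycleFold n, QWalk.isSymmetrizedQuotient_cycleFold hn⟩⟩
  rintro ⟨k, hk, rfl⟩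
  obtain ⟨m, rfl⟩ := Nat.exists_eq_add_of_le' hk
  exact QWalk.admitsVertexPGST_two_pow m
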